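/- **Setting.** Let $B_n$ be the Artin braid group on $n$ strands with generators $\sigma_1,\dots,\sigma_{n-1}$, $\rho:B_n\to S_n$ the standard homomorphism and $PB_n=\ker\rho$. Let $\mathsf{PaB}^{\le 4}$ be the truncated operad of parenthesized braids in arities $\le 4$. Objects of $\mathsf{PaB}(n)$ are parenthesized permutations of $1,\dots,n$; morphisms from $\tau_1$ to $\tau_2$ are the braids in $B_n$ connecting equal labels; $S_n$ acts by relabelling; the insertion $\gamma\circ_i\tilde\gamma$ replaces the strand of $\gamma$ starting at the label $i$ by a thin version of $\tilde\gamma$. Let $\alpha:(12)3\to 1(23)$ be the associator (given by the trivial braid). For $g\in B_n$ let $\mathfrak m(g)$ be the morphism of $\mathsf{PaB}(n)$ with source $(\cdots((1\,2)\,3)\cdots)\,n$ given by $g$ and with left-bracketed target. All morphisms of truncated operads (in groupoids) below are the identity on objects. Let $\mathsf{NFI}$ be the poset, under inclusion, of finite index normal subgroups $N$ of $B_4$ with $N\le PB_4$. For $N\in\mathsf{NFI}$ put $N_{PB_4}=N$. Let $N_{PB_3}\le PB_3$ consist of the pure braids whose images under doubling any one of the three strands, adding a trivial strand on the right, and adding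 a trivial strand on the left all lie in $N$; define $N_{PB_2}\le PB_2$ from $N_{PB_3}$ in the same way. For parallel morphisms of $\mathsf{PaB}(n)$, $2\le n\le 4$, put $\gamma\sim_N\tilde\gamma$ iff the braid of $\gamma^{-1}\tilde\gamma$ lies in $N_{PB_n}$ (in arity $1$ there are only identities). Then $\mathsf{PaB}^{\le4}/{\sim_N}$ is a truncated operad, with projection $\mathcal P_N:\mathsf{PaB}^{\le4}\to\mathsf{PaB}^{\le4}/{\sim_N}$, and, for $K\le N$, $\mathcal P_{K,N}:\mathsf{PaB}^{\le4}/{\sim_K}\to\mathsf{PaB}^{\le4}/{\sim_N}$. A *GT-shadow* with target $N$ is an onto morphism of truncated operads $T:\mathsf{PaB}^{\le4}\to\mathsf{PaB}^{\le4}/{\sim_N}$. It induces homomorphisms $T^{B_n}:B_n\to B_n/N_{PB_n}$, sending $g$ to the coset of the braid of $T(\mathfrak m(g))$. Let $x_{12}=\sigma_1^2$, $x_{23}=\sigma_2^2$ and $F_2=\langle x_{12},x_{23}\rangle\le PB_3$. The shadow $T$ is *charming* if the coset in $B_3/N_{PB_3}$ of the braid of $T(\alpha)$ is represented by an element of $[F_2,F_2]$,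 and the homomorphism $F_2\to F_2/(F_2\cap N_{PB_3})$ induced by $T^{B_3}$ is onto. Let $\mathsf{GT}^\heartsuit(N)$ be the set of charming GT-shadows with target $N$. The element $N$ is *isolated* if $\ker T^{B_4}=N$ for every $T\in\mathsf{GT}^\heartsuit(N)$. **Proposition.** For every isolated $N$, each $T\in \mathsf{GT}^\heartsuit(N)$ factors as $T=T^{\mathrm{isom}}\circ\mathcal P_N$ for a unique automorphism $T^{\mathrm{isom}}$ of the truncated operad $\mathsf{PaB}^{\le4}/{\sim_N}$, and $\mathsf{GT}^\heartsuit(N)$ with the multiplication $(T_1,T_2)\mapsto T_1^{\mathrm{isom}}\circ T_2$ is a finite group $\mathcal{ML}(N)$. For isolated $K\le N$, the assignment $T\mapsto\mathcal P_{K,N}\circ T$ is a well-defined group homomorphism $\mathcal{ML}_{K,N}:\mathcal{ML}(K)\to\mathcal{ML}(N)$. One has $\mathcal{ML}_{N,N}=\mathrm{id}$ and $\mathcal{ML}_{N^{(2)},N^{(3)}}\circ\mathcal{ML}_{N^{(1)},N^{(2)}}=\mathcal{ML}_{N^{(1)},N^{(3)}}$ for isolated $N^{(1)}\le N^{(2)}\le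 N^{(3)}$. Thus $N\mapsto\mathcal{ML}(N)$ is a functor from the poset of isolated elements to the category of finite groups. -/

import Mathlib

open CategoryTheory

namespace GTShadow

/-- Artin's relations between the generators `σ_1, …, σ_{n-1}` (here numbered from `0`). -/
def braidRels (n : ℕ) : Set (FreeGroup (Fin (n - 1))) :=
  {r | ∃ i j : Fin (n - 1), (i : ℕ) + 2 ≤ j ∧
      r = FreeGroup.of i * FreeGroup.of j * (FreeGroup.of i)⁻¹ * (FreeGroup.of j)⁻¹} ∪
  {r | ∃ i j : Fin (n - 1), (i : ℕ) + 1 = j ∧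
      r = FreeGroup.of i * FreeGroup.of j * FreeGroup.of i *
        (FreeGroup.of j)⁻¹ * (FreeGroup.of i)⁻¹ * (FreeGroup.of j)⁻¹}

/-- The Artin braid group on `n` strands. A product `g * h` is the braid `h` followed by the braid `g`. -/
abbrev Braid (n : ℕ) : Type := PresentedGroup (braidRels n)

/-- The generator of `Braid n` which crosses the strand at position `j` over the strand at position
`j + 1`; positions are numbered from `0`. (It is `1` when there is no such generator.) -/
def sg (n j : ℕ) : Braid n :=
  if h : j < n - 1 then PresentedGroup.of ⟨j, h⟩ else 1

theorem sg_comm (n : ℕ) {i j : ℕ} (hij : i + 2 ≤ j) : sg n i * sg n j = sg n j * sg n i := by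
  unfold sg
  split_ifs with hi hj
  · have h : PresentedGroup.mk (braidRels n) _ = 1 := PresentedGroup.one_of_mem
      (Or.inl ⟨⟨i, hi⟩, ⟨j, hj⟩, hij, rfl⟩)
    simp only [map_mul, map_inv] at h
    rw [mul_inv_eq_one, mul_inv_eq_iff_eq_mul] at h
    exact h
  all_goals simp

theorem sg_braid (n : ℕ) {i : ℕ} (hi : i + 2 < n) :
    sg n i * sg n (i + 1) * sg n i = sg n (i + 1) * sg n i * sg n (i + 1) := by
  have h1 : i < n - 1 := by omega
  have h2 : i + 1 < n - 1 := by omega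
  unfold sg
  rw [dif_pos h1, dif_pos h2]
  have h : PresentedGroup.mk (braidRels n) _ = 1 := PresentedGroup.one_of_mem
    (Or.inr ⟨⟨i, h1⟩, ⟨i + 1, h2⟩, rfl, rfl⟩)
  simp only [map_mul, map_inv] at h
  rw [mul_inv_eq_one, mul_inv_eq_iff_eq_mul, mul_inv_eq_iff_eq_mul] at h
  exact h

/-- The homomorphism out of the braid group defined by its values on the generators. -/
def braidLift {G : Type} [Group G] (n : ℕ) (f : ℕ → G)
    (far : ∀ i j, i + 2 ≤ j → j + 1 < n → f i * f j = f j * f i)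
    (br : ∀ i, i + 2 < n → f i * f (i + 1) * f i = f (i + 1) * f i * f (i + 1)) : Braid n →* G :=
  PresentedGroup.toGroup (f := fun i : Fin (n - 1) => f i) (by
    rintro r (⟨i, j, hij, rfl⟩ | ⟨i, j, hij, rfl⟩)
    · have := far i j hij (by omega)
      simp [this]
    · have := br i (by omega)
      simp only [hij] at this
      simp [this])

theorem braidLift_sg {G : Type} [Group G] (n : ℕ) (f : ℕ → G) (far) (br) {j : ℕ}
    (hj : j + 1 < n) : braidLift n f far br (sg n j) = f j := by
  have h1 : j < n - 1 := by omega
  simp [braidLift, sg, h1]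

theorem braid_induction {n : ℕ} {P : Braid n → Prop} (one : P 1)
    (gen : ∀ j, j + 1 < n → P (sg n j)) (mul : ∀ x y, P x → P y → P (x * y))
    (inv : ∀ x, P x → P x⁻¹) (g : Braid n) : P g := by
  have hg : g ∈ Subgroup.closure (Set.range (PresentedGroup.of (rels := braidRels n))) := by
    rw [PresentedGroup.closure_range_of]; trivial
  induction hg using Subgroup.closure_induction with
  | mem x hx =>
    obtain ⟨i, rfl⟩ := hx
    have := gen i (by omega)
    simpa [sg] using this
  | one => exact one
  | mul x y _ _ hx hy => exact mul x y hx hy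
  | inv x _ hx => exact inv x hx

/-- The transposition of the positions `j` and `j + 1`. -/
def adj (n j : ℕ) : Equiv.Perm (Fin n) :=
  if h : j + 1 < n then Equiv.swap ⟨j, by omega⟩ ⟨j + 1, h⟩ else 1

theorem adj_val {n j : ℕ} (h : j + 1 < n) (x : Fin n) :
    (adj n j x : ℕ) = if (x : ℕ) = j then j + 1 else if (x : ℕ) = j + 1 then j else x := by
  simp only [adj, dif_pos h, Equiv.swap_apply_def, Fin.ext_iff]
  split_ifs <;> simp

theorem adj_comm (n i j : ℕ) (hij : i + 2 ≤ j) (hj : j + 1 < n) :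
    adj n i * adj n j = adj n j * adj n i := by
  ext x
  simp only [Equiv.Perm.mul_apply]
  rw [adj_val (by omega), adj_val (by omega), adj_val (by omega), adj_val (by omega)]
  grind

theorem adj_braid (n i : ℕ) (hi : i + 2 < n) :
    adj n i * adj n (i + 1) * adj n i = adj n (i + 1) * adj n i * adj n (i + 1) := by
  ext x
  simp only [Equiv.Perm.mul_apply]
  rw [adj_val (by omega), adj_val (by omega), adj_val (by omega), adj_val (by omega),
    adj_val (by omega), adj_val (by omega)]
  grind

/-- The standard homomorphism from the braid group to the symmetric group; `rho n g p` is the final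
position of the strand of `g` that starts at position `p`. -/
def rho (n : ℕ) : Braid n →* Equiv.Perm (Fin n) :=
  braidLift n (adj n) (adj_comm n) (adj_braid n)

/-- The `j`-th generator with one strand replaced by two parallel strands, namely the strand which
ends at position `q`. -/
def dbl (n j q : ℕ) : Braid (n + 1) :=
  if q < j then sg (n + 1) (j + 1)
  else if q = j then sg (n + 1) (j + 1) * sg (n + 1) j
  else if q = j + 1 then sg (n + 1) j * sg (n + 1) (j + 1)
  else sg (n + 1) j

/-- The doublings of the `j`-th generator, for all strands at once, together with its permutation. -/
def dblGen (n j : ℕ) : (Fin n → Braid (n + 1)) ⋊[mulAutArrow] Equiv.Perm (Fin n) :=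
  ⟨fun q => dbl n j q, adj n j⟩

theorem adj_inv (n j : ℕ) : (adj n j)⁻¹ = adj n j := by
  unfold adj; split_ifs <;> simp


theorem dblGen_mul_left {n : ℕ} (a b : (Fin n → Braid (n + 1)) ⋊[mulAutArrow] Equiv.Perm (Fin n))
    (q : Fin n) : (a * b).left q = a.left q * b.left (a.right⁻¹ q) := rfl

theorem dblGen_comm (n i j : ℕ) (hij : i + 2 ≤ j) (hj : j + 1 < n) :
    dblGen n i * dblGen n j = dblGen n j * dblGen n i := by
  have c1 : Commute (sg (n + 1) i) (sg (n + 1) j) := sg_comm (n + 1) hij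
  have c2 : Commute (sg (n + 1) i) (sg (n + 1) (j + 1)) := sg_comm (n + 1) (by omega)
  have c3 : Commute (sg (n + 1) (i + 1)) (sg (n + 1) (j + 1)) := sg_comm (n + 1) (by omega)
  refine SemidirectProduct.ext (funext fun q => ?_) (adj_comm n i j hij hj)
  simp only [dblGen_mul_left, dblGen, adj_inv]
  have e1 := adj_val (n := n) (j := i) (by omega) q
  have e2 := adj_val (n := n) (j := j) (by omega) q
  have f1 : dbl n i (adj n j q) = dbl n i q := by
    rw [e2]; unfold dbl; split_ifs <;> first | rfl | omega
  have f2 : dbl n j (adj n i q) = dbl n j q := by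
    rw [e1]; unfold dbl; split_ifs <;> first | rfl | omega
  rw [f1, f2]
  unfold dbl
  split_ifs <;> first
    | omega
    | exact c1
    | exact c2
    | exact c3
    | exact c3.mul_left c2
    | exact c2.mul_left c3
    | exact c2.mul_right c1
    | exact c1.mul_right c2

theorem braid_block {G : Type} [Group G] {a b c : G} (h1 : a * b * a = b * a * b)
    (h2 : b * c * b = c * b * c) (h3 : a * c = c * a) :
    b * a * (c * b) * a = c * (b * a) * (c * b) ∧
    a * b * c * (b * a) = c * b * a * (b * c) ∧
    a * (b * c) * (a * b) = b * c * (a * b) * c := by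
  refine ⟨?_, ?_, ?_⟩
  · calc b * a * (c * b) * a = b * (a * c) * b * a := by group
      _ = b * c * (a * b * a) := by rw [h3]; group
      _ = (b * c * b) * a * b := by rw [h1]; group
      _ = c * b * (c * a) * b := by rw [h2]; group
      _ = c * (b * a) * (c * b) := by rw [← h3]; group
  · calc a * b * c * (b * a) = a * (b * c * b) * a := by group
      _ = (a * c) * b * (c * a) := by rw [h2]; group
      _ = c * (a * b * a) * c := by rw [← h3]; nth_rw 1 [h3]; group
      _ = c * b * a * (b * c) := by rw [h1]; group
  · calc a * (b * c) * (a * b) = a * b * (c * a) * b := by group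
      _ = (a * b * a) * c * b := by rw [← h3]; group
      _ = b * a * (b * c * b) := by rw [h1]; group
      _ = b * (a * c) * b * c := by rw [h2]; group
      _ = b * c * (a * b) * c := by rw [h3]; group

theorem dblGen_braid (n i : ℕ) (hi : i + 2 < n) :
    dblGen n i * dblGen n (i + 1) * dblGen n i =
      dblGen n (i + 1) * dblGen n i * dblGen n (i + 1) := by
  have h1 := sg_braid (n + 1) (i := i) (by omega)
  have h2 := sg_braid (n + 1) (i := i + 1) (by omega)
  have h3 := sg_comm (n + 1) (i := i) (j := i + 1 + 1) (by omega)
  refine SemidirectProduct.ext (funext fun q => ?_) (adj_braid n i hi)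
  simp only [dblGen_mul_left, dblGen, adj_inv, SemidirectProduct.mul_right, mul_inv_rev,
    Equiv.Perm.mul_apply]
  have e : ∀ j, j + 1 < n → ∀ x : Fin n, _ := fun j hj x => adj_val (n := n) (j := j) hj x
  rw [e i (by omega) q, e (i + 1) (by omega) q, e (i + 1) (by omega), e i (by omega),
    e i (by omega), e (i + 1) (by omega) q]
  obtain ⟨b1, b2, b3⟩ := braid_block h1 h2 h3
  unfold dbl
  generalize (q : ℕ) = x
  rcases (by omega : x < i ∨ x = i ∨ x = i + 1 ∨ x = i + 2 ∨ i + 2 < x) with h | h | h | h | h <;>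
    simp (disch := omega) only [if_pos, if_neg, if_true] <;> assumption

/-- Doubling of a strand satisfies `double (g * h) p = double g (rho h p) * double h p`, so that the
doublings of all strands form a homomorphism to a semidirect product. -/
def dblHom (n : ℕ) : Braid n →* (Fin n → Braid (n + 1)) ⋊[mulAutArrow] Equiv.Perm (Fin n) :=
  braidLift n (dblGen n) (dblGen_comm n) (dblGen_braid n)

theorem dblHom_right (n : ℕ) (g : Braid n) : (dblHom n g).right = rho n g := by
  induction g using braid_induction with
  | one => simp
  | gen j hj => rw [dblHom, braidLift_sg n _ _ _ hj, rho, braidLift_sg n _ _ _ hj]; rfl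
  | mul x y hx hy => simp [hx, hy]
  | inv x hx => simp [hx]

/-- The braid obtained from `g` by replacing the strand that starts at position `p` by two parallel
strands. -/
def double {n : ℕ} (g : Braid n) (p : Fin n) : Braid (n + 1) := (dblHom n g).left (rho n g p)

theorem double_mul {n : ℕ} (g h : Braid n) (p : Fin n) :
    double (g * h) p = double g (rho n h p) * double h p := by
  simp [double, dblGen_mul_left, dblHom_right]

theorem double_one {n : ℕ} (p : Fin n) : double (1 : Braid n) p = 1 := by
  simp [double]

theorem double_inv {n : ℕ} (g : Braid n) (p : Fin n) :
    double g⁻¹ p = (double g ((rho n g)⁻¹ p))⁻¹ := by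
  rw [eq_inv_iff_mul_eq_one]
  have := double_mul g⁻¹ g ((rho n g)⁻¹ p)
  simp [double_one] at this
  exact this.symm

theorem double_sg {n j : ℕ} (hj : j + 1 < n) (p : Fin n) :
    double (sg n j) p = dbl n j (adj n j p) := by
  simp only [double, dblHom, rho, braidLift_sg n _ _ _ hj]; rfl

/-- The homomorphism that places a braid on `m` strands on the strands at positions
`p, …, p + m - 1` of `n` strands, the other strands being trivial. -/
def shift (m n p : ℕ) (h : p + m ≤ n) : Braid m →* Braid n :=
  braidLift m (fun j => sg n (p + j)) (fun i j hij _ => sg_comm n (by omega))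
    (fun i hi => sg_braid n (by omega))

theorem shift_sg {m n p : ℕ} (h : p + m ≤ n) {j : ℕ} (hj : j + 1 < m) :
    shift m n p h (sg m j) = sg n (p + j) := braidLift_sg _ _ _ _ hj

/-- The braid obtained from `g` by replacing the strand that starts at position `p` by `k + 1`
parallel strands. -/
def cable {n : ℕ} (g : Braid n) (p : Fin n) : (k : ℕ) → Braid (n + k)
  | 0 => g
  | k + 1 => double (cable g p k) (Fin.castAdd k p)

/-- The positions `0, …, n + k - 1`, obtained by replacing the position `p` among `0, …, n - 1` by a
block of `k + 1` consecutive positions. -/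
def toBlock {n : ℕ} (k : ℕ) (p : Fin n) : Fin (n + k) ≃ {x : Fin n // x ≠ p} ⊕ Fin (k + 1) where
  toFun x :=
    if h₁ : (x : ℕ) < (p : ℕ) then Sum.inl ⟨⟨x, by omega⟩, fun h => by simp [Fin.ext_iff] at h; omega⟩
    else if h₂ : (x : ℕ) ≤ p + k then Sum.inr ⟨x - p, by omega⟩
    else Sum.inl ⟨⟨x - k, by omega⟩, fun h => by simp [Fin.ext_iff] at h; omega⟩
  invFun := Sum.elim
    (fun y => if ((y : Fin n) : ℕ) < (p : ℕ) then ⟨(y : Fin n), by omega⟩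
      else ⟨((y : Fin n) : ℕ) + k, by omega⟩)
    (fun y => ⟨p + y, by omega⟩)
  left_inv x := by
    dsimp only
    split_ifs with h₁ h₂
    · simp only [Sum.elim_inl, if_pos h₁]
    · simp [Fin.ext_iff]; omega
    · simp only [Sum.elim_inl]
      rw [if_neg (by omega)]
      simp [Fin.ext_iff]; omega
  right_inv y := by
    rcases y with ⟨y, hy⟩ | y
    · have : (y : ℕ) ≠ p := fun h => hy (Fin.ext h)
      simp only [Sum.elim_inl]
      by_cases h : (y : ℕ) < p
      · simp [h]
      · simp only [if_neg h]
        rw [dif_neg (by omega), dif_neg (by omega)]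
        simp
    · have := y.2
      simp [show (y : ℕ) ≤ k by omega]

/-- The permutation that moves the block which replaces `p` to the block which replaces `s p`,
permutes its content by `t`, and permutes the other positions by `s`. -/
def insPerm {n k : ℕ} (s : Equiv.Perm (Fin n)) (t : Equiv.Perm (Fin (k + 1))) (p : Fin n) :
    Equiv.Perm (Fin (n + k)) :=
  (toBlock k p).trans
    ((Equiv.sumCongr (s.subtypeEquiv fun _ => not_congr s.injective.eq_iff.symm) t).trans
      (toBlock k (s p)).symm)

theorem insPerm_mul {n k : ℕ} (s' s : Equiv.Perm (Fin n)) (t' t : Equiv.Perm (Fin (k + 1)))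
    (p : Fin n) : insPerm (s' * s) (t' * t) p = insPerm s' t' (s p) * insPerm s t p := by
  ext x
  simp only [insPerm, Equiv.trans_apply, Equiv.Perm.mul_apply, Equiv.apply_symm_apply]
  rcases toBlock k p x with y | y <;> rfl

theorem insPerm_one {n k : ℕ} (p : Fin n) :
    insPerm (1 : Equiv.Perm (Fin n)) (1 : Equiv.Perm (Fin (k + 1))) p = 1 := by
  have h := insPerm_mul (1 : Equiv.Perm (Fin n)) 1 (1 : Equiv.Perm (Fin (k + 1))) 1 p
  rw [mul_one, mul_one, Equiv.Perm.one_apply] at h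
  exact (mul_eq_left.mp h.symm)

theorem insPerm_inv {n k : ℕ} (s : Equiv.Perm (Fin n)) (t : Equiv.Perm (Fin (k + 1)))
    (p : Fin n) : (insPerm s t p)⁻¹ = insPerm s⁻¹ t⁻¹ (s p) := by
  have h := insPerm_mul s⁻¹ s t⁻¹ t p
  rw [inv_mul_cancel, inv_mul_cancel, insPerm_one] at h
  exact inv_eq_of_mul_eq_one_left h.symm

/-- The place of `a` after `b` has been replaced by a block of length `k + 1`, when `a ≠ b`. -/
def spread (k b a : ℕ) : ℕ := if a < b then a else a + k

theorem insPerm_val {n k : ℕ} (s : Equiv.Perm (Fin n)) (t : Equiv.Perm (Fin (k + 1)))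
    (p : Fin n) (x : Fin (n + k)) : (insPerm s t p x : ℕ) =
      if h₁ : (x : ℕ) < p then spread k (s p) (s ⟨x, by omega⟩)
      else if h₂ : (x : ℕ) ≤ p + k then s p + t ⟨x - p, by omega⟩
      else spread k (s p) (s ⟨x - k, by omega⟩) := by
  simp only [spread, insPerm, Equiv.trans_apply, toBlock, Equiv.coe_fn_mk, Equiv.coe_fn_symm_mk]
  split_ifs <;> simp [Equiv.subtypeEquiv, -Fin.val_fin_lt, *]

theorem rho_sg {n j : ℕ} (hj : j + 1 < n) : rho n (sg n j) = adj n j := braidLift_sg _ _ _ _ hj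

theorem rho_double {n : ℕ} (g : Braid n) (p : Fin n) :
    rho (n + 1) (double g p) = insPerm (rho n g) (1 : Equiv.Perm (Fin 2)) p := by
  induction g using braid_induction generalizing p with
  | one => simp [double_one, insPerm_one]
  | gen j hj =>
    rw [double_sg hj, rho_sg hj]
    ext x
    rw [insPerm_val]
    simp only [adj_val hj]
    have a0 := adj_val (n := n + 1) (j := j) (by omega)
    have a1 := adj_val (n := n + 1) (j := j + 1) (by omega)
    have r0 := rho_sg (n := n + 1) (j := j) (by omega)
    have r1 := rho_sg (n := n + 1) (j := j + 1) (by omega)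
    unfold dbl
    unfold spread
    rcases (by omega : (p : ℕ) < j ∨ (p : ℕ) = j ∨ (p : ℕ) = j + 1 ∨ j + 1 < (p : ℕ)) with
      h | h | h | h <;>
    simp (disch := omega) only [if_pos, if_neg, if_true, map_mul, r0, r1, Equiv.Perm.mul_apply,
      a0, a1, Equiv.Perm.one_apply] <;> split_ifs <;> omega
  | mul x y hx hy =>
    rw [double_mul, map_mul, map_mul, hx, hy, ← insPerm_mul, mul_one]
  | inv x hx =>
    rw [double_inv, map_inv, hx, insPerm_inv]
    simp

theorem rho_cable {n : ℕ} (g : Braid n) (p : Fin n) (k : ℕ) :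
    rho (n + k) (cable g p k) = insPerm (rho n g) (1 : Equiv.Perm (Fin (k + 1))) p := by
  induction k with
  | zero =>
    ext x
    rw [insPerm_val]
    by_cases h : (x : ℕ) = p
    · have hx : x = p := Fin.ext h
      subst hx
      simp [cable]
    · have h1 : ¬ ((x : ℕ) ≤ p + 0 ∧ ¬ (x : ℕ) < p) := by omega
      unfold spread
      split_ifs <;> first | rfl | omega
  | succ k ih =>
    refine (rho_double (cable g p k) (Fin.castAdd k p)).trans ?_
    rw [ih]
    have hp : (insPerm (rho n g) (1 : Equiv.Perm (Fin (k + 1))) p (Fin.castAdd k p) : ℕ) =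
        rho n g p := by
      rw [insPerm_val]; simp
    ext x
    rw [insPerm_val (n := n + k), hp]
    simp only [insPerm_val, Fin.val_castAdd, Equiv.Perm.one_apply]
    have hs : (x : ℕ) - 1 - k = x - (k + 1) := by omega
    simp only [hs, spread]
    split_ifs <;> omega

theorem rho_shift {n k : ℕ} (p : Fin n) (h : Braid (k + 1)) :
    rho (n + k) (shift (k + 1) (n + k) p (by omega) h) =
      insPerm (1 : Equiv.Perm (Fin n)) (rho (k + 1) h) p := by
  induction h using braid_induction with
  | one => simp [insPerm_one]
  | gen j hj =>
    rw [shift_sg _ hj, rho_sg (by omega), rho_sg hj]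
    ext x
    rw [insPerm_val, adj_val (by omega)]
    simp only [adj_val hj, Equiv.Perm.one_apply]
    unfold spread
    split_ifs <;> omega
  | mul x y hx hy =>
    have := insPerm_mul (1 : Equiv.Perm (Fin n)) 1 (rho (k + 1) x) (rho (k + 1) y) p
    rw [mul_one, Equiv.Perm.one_apply] at this
    rw [map_mul, map_mul, map_mul, hx, hy, this]
  | inv x hx =>
    rw [map_inv, map_inv, map_inv, hx, insPerm_inv, inv_one, Equiv.Perm.one_apply]

/-- The braid obtained from `g` by replacing the strand that starts at position `p` by a thin
version of `h`. -/
def insBraid {n k : ℕ} (g : Braid n) (p : Fin n) (h : Braid (k + 1)) : Braid (n + k) :=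
  cable g p k * shift (k + 1) (n + k) p (by omega) h

theorem rho_insBraid {n k : ℕ} (g : Braid n) (p : Fin n) (h : Braid (k + 1)) :
    rho (n + k) (insBraid g p h) = insPerm (rho n g) (rho (k + 1) h) p := by
  rw [insBraid, map_mul, rho_cable, rho_shift]
  have := insPerm_mul (rho n g) 1 1 (rho (k + 1) h) p
  rw [mul_one, one_mul, Equiv.Perm.one_apply] at this
  exact this.symm

/-- Replace the leaf at position `p` (from the left, starting with `0`) of a bracketing by the
bracketing `u`. -/
def graft : FreeMagma Unit → ℕ → FreeMagma Unit → FreeMagma Unit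
  | .of _, _, u => u
  | .mul t t', p, u =>
    if p < t.length then .mul (graft t p u) t' else .mul t (graft t' (p - t.length) u)

theorem graft_length (t : FreeMagma Unit) (p : ℕ) (u : FreeMagma Unit) :
    (graft t p u).length + 1 = t.length + u.length := by
  induction t generalizing p with
  | ih1 _ => simp [graft, FreeMagma.length]; omega
  | ih2 t t' h h' =>
    change (if p < t.length then FreeMagma.mul (graft t p u) t'
      else FreeMagma.mul t (graft t' (p - t.length) u)).length + 1 =
        t.length + t'.length + u.length
    have := h p
    have := h' (p - t.length)
    split_ifs <;> simp only [FreeMagma.length] <;> omega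

/-- Objects of the groupoid `PaB(n)`: bracketings of the sequence `τ(1), …, τ(n)` where `τ` is a
permutation; `label` is `τ`, it sends a position to the label at this position. -/
structure PObj (n : ℕ) where
  tree : FreeMagma Unit
  length_tree : tree.length = n
  label : Equiv.Perm (Fin n)

namespace PObj

/-- The action of the symmetric group: relabelling. -/
def act {n : ℕ} (θ : Equiv.Perm (Fin n)) (a : PObj n) : PObj n :=
  ⟨a.tree, a.length_tree, θ * a.label⟩

/-- The insertion `a ∘_i b`: the leaf labelled `i` is replaced by `b`; the labels of `b` are raised
so as to start with `i`, and the labels of `a` greater than `i` are raised by `k`. -/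
def ins {n k : ℕ} (a : PObj n) (i : Fin n) (b : PObj (k + 1)) : PObj (n + k) where
  tree := graft a.tree (a.label⁻¹ i : Fin n) b.tree
  length_tree := by
    have := graft_length a.tree (a.label⁻¹ i : Fin n) b.tree
    rw [a.length_tree, b.length_tree] at this
    omega
  label := insPerm a.label b.label (a.label⁻¹ i)

end PObj

/-- Morphisms of `PaB(n)` from `a` to `b`: braids on `n` strands which connect equal labels. -/
def PHom {n : ℕ} (a b : PObj n) : Type := {g : Braid n // rho n g = b.label⁻¹ * a.label}

namespace PHom

/-- The identity morphism. -/
def id {n : ℕ} (a : PObj n) : PHom a a := ⟨1, by simp⟩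

/-- Composition comes from the multiplication of braids; `comp γ δ` is `δ` followed by `γ`. -/
def comp {n : ℕ} {a b c : PObj n} (γ : PHom b c) (δ : PHom a b) : PHom a c :=
  ⟨γ.1 * δ.1, by rw [map_mul, γ.2, δ.2]; group⟩

/-- The inverse morphism. -/
def inv {n : ℕ} {a b : PObj n} (γ : PHom a b) : PHom b a :=
  ⟨γ.1⁻¹, by rw [map_inv, γ.2]; group⟩

/-- The action of the symmetric group does not change the braid. -/
def act {n : ℕ} {a b : PObj n} (θ : Equiv.Perm (Fin n)) (γ : PHom a b) :
    PHom (a.act θ) (b.act θ) :=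
  ⟨γ.1, by rw [γ.2]; simp only [PObj.act]; group⟩

/-- The elementary insertion `γ ∘_i δ` of morphisms: the strand of `γ` which starts at the position
labelled `i` is replaced by a thin version of `δ`. -/
def ins {n k : ℕ} {a a' : PObj n} {b b' : PObj (k + 1)} (γ : PHom a a') (i : Fin n)
    (δ : PHom b b') : PHom (a.ins i b) (a'.ins i b') :=
  ⟨insBraid γ.1 (a.label⁻¹ i) δ.1, by
    have h := insPerm_mul a'.label⁻¹ a.label b'.label⁻¹ b.label (a.label⁻¹ i)
    have e : a.label (a.label⁻¹ i) = i := a.label.apply_symm_apply i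
    have e' : a'.label (a'.label⁻¹ i) = i := a'.label.apply_symm_apply i
    rw [rho_insBraid, γ.2, δ.2, h, e]
    simp only [PObj.ins]
    rw [insPerm_inv, e']⟩

end PHom

/-- The operations of a `4`-truncated operad in groupoids (composition, identities and inverses in
arities `n ≤ 4`, symmetric group actions, elementary insertions) with the same operad of objects as
`PaB`. This is only used for `PaB` and its quotients, where all operations are explicit; the laws are
not recorded, since the notion of a morphism does not involve them. -/
structure TruncOp : Type 1 where
  Hom {n : ℕ} (hn : n ≤ 4) (a b : PObj n) : Type
  id {n : ℕ} {hn : n ≤ 4} (a : PObj n) : Hom hn a a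
  comp {n : ℕ} {hn : n ≤ 4} {a b c : PObj n} : Hom hn b c → Hom hn a b → Hom hn a c
  inv {n : ℕ} {hn : n ≤ 4} {a b : PObj n} : Hom hn a b → Hom hn b a
  act {n : ℕ} {hn : n ≤ 4} {a b : PObj n} (θ : Equiv.Perm (Fin n)) :
    Hom hn a b → Hom hn (a.act θ) (b.act θ)
  ins {n k : ℕ} {hn : n ≤ 4} {hk : k + 1 ≤ 4} {hnk : n + k ≤ 4} {a a' : PObj n}
    {b b' : PObj (k + 1)} (i : Fin n) :
    Hom hn a a' → Hom hk b b' → Hom hnk (a.ins i b) (a'.ins i b')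

namespace TruncOp

/-- Morphisms of truncated operads in groupoids which are the identity on objects. -/
@[ext]
structure Mor (P Q : TruncOp) where
  map {n : ℕ} {hn : n ≤ 4} {a b : PObj n} : P.Hom hn a b → Q.Hom hn a b
  map_id {n : ℕ} {hn : n ≤ 4} (a : PObj n) : map (P.id (hn := hn) a) = Q.id a
  map_comp {n : ℕ} {hn : n ≤ 4} {a b c : PObj n} (γ : P.Hom hn b c) (δ : P.Hom hn a b) :
    map (P.comp γ δ) = Q.comp (map γ) (map δ)
  map_inv {n : ℕ} {hn : n ≤ 4} {a b : PObj n} (γ : P.Hom hn a b) :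
    map (P.inv γ) = Q.inv (map γ)
  map_act {n : ℕ} {hn : n ≤ 4} {a b : PObj n} (θ : Equiv.Perm (Fin n)) (γ : P.Hom hn a b) :
    map (P.act θ γ) = Q.act θ (map γ)
  map_ins {n k : ℕ} {hn : n ≤ 4} {hk : k + 1 ≤ 4} {hnk : n + k ≤ 4} {a a' : PObj n}
    {b b' : PObj (k + 1)} (i : Fin n) (γ : P.Hom hn a a') (δ : P.Hom hk b b') :
    map (P.ins (hnk := hnk) i γ δ) = Q.ins i (map γ) (map δ)

/-- The category formed by truncated operads and their morphisms; `S ≫ T` is `S` followed by `T`. -/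
instance : CategoryTheory.Category TruncOp where
  Hom := Mor
  id P := ⟨fun γ => γ, fun _ => rfl, fun _ _ => rfl, fun _ => rfl, fun _ _ => rfl,
    fun _ _ _ => rfl⟩
  comp S T := ⟨fun γ => T.map (S.map γ), fun a => by rw [S.map_id, T.map_id],
    fun γ δ => by rw [S.map_comp, T.map_comp], fun γ => by rw [S.map_inv, T.map_inv],
    fun θ γ => by rw [S.map_act, T.map_act], fun i γ δ => by rw [S.map_ins, T.map_ins]⟩

end TruncOp

/-- The truncated operad `PaB^{≤ 4}` of parenthesized braids. -/
def PaB : TruncOp where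
  Hom _ a b := PHom a b
  id := PHom.id
  comp := PHom.comp
  inv := PHom.inv
  act := PHom.act
  ins i γ δ := PHom.ins γ i δ

/-- For a subgroup `N` of the braid group on `n + 1` strands: the pure braids on `n` strands whose
images under the cofaces (doubling of any strand, adding a trivial strand on the right or on the left)
lie in `N`. For `n = 3` the cofaces are `φ_{12,3,4}, φ_{1,23,4}, φ_{1,2,34}, φ_{123}, φ_{234}`, and for
`n = 2` they are `φ_{12,3}, φ_{1,23}, φ_{12}, φ_{23}`. -/
def pull {n : ℕ} (N : Subgroup (Braid (n + 1))) : Subgroup (Braid n) where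
  carrier := {h | rho n h = 1 ∧ (∀ p : Fin n, double h p ∈ N) ∧
    shift n (n + 1) 0 (by omega) h ∈ N ∧ shift n (n + 1) 1 (by omega) h ∈ N}
  one_mem' := by simp [double_one, N.one_mem]
  mul_mem' := by
    rintro g h ⟨g1, g2, g3, g4⟩ ⟨h1, h2, h3, h4⟩
    refine ⟨by simp [g1, h1], fun p => ?_, ?_, ?_⟩
    · rw [double_mul]; exact N.mul_mem (g2 _) (h2 p)
    · rw [map_mul]; exact N.mul_mem g3 h3
    · rw [map_mul]; exact N.mul_mem g4 h4
  inv_mem' := by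
    rintro g ⟨g1, g2, g3, g4⟩
    refine ⟨by simp [g1], fun p => ?_, ?_, ?_⟩
    · rw [double_inv]; exact N.inv_mem (g2 _)
    · rw [map_inv]; exact N.inv_mem g3
    · rw [map_inv]; exact N.inv_mem g4

theorem pull_normal {n : ℕ} (N : Subgroup (Braid (n + 1))) (hN : N.Normal) :
    (pull N).Normal := by
  refine ⟨fun h ⟨h1, h2, h3, h4⟩ g => ⟨by simp [h1], fun p => ?_, ?_, ?_⟩⟩
  · rw [double_mul, double_mul, double_inv, h1, Equiv.Perm.one_apply, map_inv]
    exact hN.conj_mem _ (h2 _) _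
  · rw [map_mul, map_mul, map_inv]; exact hN.conj_mem _ h3 _
  · rw [map_mul, map_mul, map_inv]; exact hN.conj_mem _ h4 _

/-- The pure braid group. -/
def pureBraid (n : ℕ) : Subgroup (Braid n) := (rho n).ker

/-- The finite index normal subgroups of the braid group on four strands that are contained in the
pure braid group. -/
structure NFI where
  toSubgroup : Subgroup (Braid 4)
  normal : toSubgroup.Normal
  finiteIndex : toSubgroup.FiniteIndex
  le_pure : toSubgroup ≤ pureBraid 4

namespace NFI

/-- The order is the inclusion of subgroups. -/
instance : PartialOrder NFI :=
  PartialOrder.lift toSubgroup fun ⟨_, _, _, _⟩ ⟨_, _, _, _⟩ h => by cases h; rfl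

/-- The subgroups `N_{PB_2}`, `N_{PB_3}` and `N_{PB_4} = N`. In arity `1`, where the braid group is
trivial, it is the trivial subgroup; other arities play no role. -/
def level (N : NFI) : (n : ℕ) → Subgroup (Braid n)
  | 2 => pull (pull N.toSubgroup)
  | 3 => pull N.toSubgroup
  | 4 => N.toSubgroup
  | _ => ⊥

instance level_normal (N : NFI) (n : ℕ) : (N.level n).Normal := by
  unfold level
  split
  · exact pull_normal _ (pull_normal _ N.normal)
  · exact pull_normal _ N.normal
  · exact N.normal
  · infer_instance

end NFI

theorem pull_mono {n : ℕ} {K N : Subgroup (Braid (n + 1))} (h : K ≤ N) : pull K ≤ pull N :=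
  fun _ ⟨h1, h2, h3, h4⟩ => ⟨h1, fun p => h (h2 p), h h3, h h4⟩

theorem level_mono {K N : NFI} (h : K ≤ N) (n : ℕ) : K.level n ≤ N.level n := by
  unfold NFI.level
  split
  · exact pull_mono (pull_mono h)
  · exact pull_mono h
  · exact h
  · exact le_rfl

theorem level_pure (N : NFI) {n : ℕ} {g : Braid n} (hg : g ∈ N.level n) : rho n g = 1 := by
  unfold NFI.level at hg
  split at hg
  · exact hg.1
  · exact hg.1
  · exact N.le_pure hg
  · rw [Subgroup.mem_bot.mp hg, map_one]

theorem level_coface (N : NFI) {n : ℕ} (hn : n + 1 ≤ 4) {g : Braid n} (hg : g ∈ N.level n) :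
    (∀ p : Fin n, double g p ∈ N.level (n + 1)) ∧
      shift n (n + 1) 0 (by omega) g ∈ N.level (n + 1) ∧
      shift n (n + 1) 1 (by omega) g ∈ N.level (n + 1) := by
  have triv : g = 1 → (∀ p : Fin n, double g p ∈ N.level (n + 1)) ∧
      shift n (n + 1) 0 (by omega) g ∈ N.level (n + 1) ∧
      shift n (n + 1) 1 (by omega) g ∈ N.level (n + 1) := by
    rintro rfl
    simp [double_one]
  have h3 : n ≤ 3 := by omega
  interval_cases n
  · exact triv (Subgroup.mem_bot.mp hg)
  · exact triv (Subgroup.mem_bot.mp hg)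
  · exact hg.2
  · exact hg.2

theorem cable_mem (N : NFI) {n k : ℕ} (hn : n + k ≤ 4) {g : Braid n} (hg : g ∈ N.level n)
    (p : Fin n) : cable g p k ∈ N.level (n + k) := by
  induction k with
  | zero => exact hg
  | succ k ih => exact (level_coface N hn (ih (by omega))).1 _

theorem shift_shift {l m n p q : ℕ} (h : p + l ≤ m) (h' : q + m ≤ n) (g : Braid l) :
    shift m n q h' (shift l m p h g) = shift l n (q + p) (by omega) g := by
  induction g using braid_induction with
  | one => simp
  | gen j hj =>
    rw [shift_sg _ hj, shift_sg _ hj, shift_sg _ (by omega), add_assoc]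
  | mul x y hx hy => simp only [map_mul, hx, hy]
  | inv x hx => simp only [map_inv, hx]

theorem shift_self {n : ℕ} (g : Braid n) : shift n n 0 (by omega) g = g := by
  induction g using braid_induction with
  | one => simp
  | gen j hj => rw [shift_sg _ hj, zero_add]
  | mul x y hx hy => simp only [map_mul, hx, hy]
  | inv x hx => simp only [map_inv, hx]

theorem shift_mem (N : NFI) {m n p : ℕ} (hn : n ≤ 4) (h : p + m ≤ n) {g : Braid m}
    (hg : g ∈ N.level m) : shift m n p h g ∈ N.level n := by
  induction n generalizing p with
  | zero =>
    obtain rfl : m = 0 := by omega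
    obtain rfl : p = 0 := by omega
    rwa [shift_self]
  | succ n ih =>
    by_cases h0 : p + m ≤ n
    · have := (level_coface N hn (ih (by omega) h0)).2.1
      rw [shift_shift] at this
      simpa using this
    · rcases p with _ | p
      · obtain rfl : m = n + 1 := by omega
        rwa [shift_self]
      · have := (level_coface N hn (ih (p := p) (by omega) (by omega))).2.2
        rw [shift_shift] at this
        simpa [add_comm] using this

theorem mul_rel {G : Type} [Group G] {L : Subgroup G} [hL : L.Normal] {a a' b b' : G}
    (ha : a⁻¹ * a' ∈ L) (hb : b⁻¹ * b' ∈ L) : (a * b)⁻¹ * (a' * b') ∈ L := by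
  have h := L.mul_mem hb (hL.conj_mem _ ha b'⁻¹)
  convert h using 1
  group

theorem cable_mul {n : ℕ} (g h : Braid n) (p : Fin n) (k : ℕ) (hh : rho n h = 1) :
    cable (g * h) p k = cable g p k * cable h p k := by
  induction k with
  | zero => rfl
  | succ k ih =>
    have e : rho (n + k) (cable h p k) (Fin.castAdd k p) = Fin.castAdd k p := by
      rw [rho_cable, hh, insPerm_one, Equiv.Perm.one_apply]
    calc cable (g * h) p (k + 1) = double (cable g p k * cable h p k) (Fin.castAdd k p) := by
          rw [← ih]; rfl
      _ = double (cable g p k) (Fin.castAdd k p) * double (cable h p k) (Fin.castAdd k p) := by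
          rw [double_mul, e]

theorem insBraid_rel (N : NFI) {n k : ℕ} (hnk : n + k ≤ 4) {g g' : Braid n} {h h' : Braid (k + 1)}
    (p : Fin n) (hg : g⁻¹ * g' ∈ N.level n) (hh : h⁻¹ * h' ∈ N.level (k + 1)) :
    (insBraid g p h)⁻¹ * insBraid g' p h' ∈ N.level (n + k) := by
  refine mul_rel ?_ ?_
  · have e : g' = g * (g⁻¹ * g') := by group
    rw [e, cable_mul _ _ _ _ (level_pure N hg), inv_mul_cancel_left]
    exact cable_mem N hnk hg p
  · rw [← map_inv, ← map_mul]
    exact shift_mem N hnk _ hh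

/-- The equivalence relation `∼_N` on parallel morphisms of `PaB(n)`. -/
def rel (N : NFI) {n : ℕ} (a b : PObj n) : Setoid (PHom a b) where
  r γ δ := γ.1⁻¹ * δ.1 ∈ N.level n
  iseqv := by
    refine ⟨fun γ => ?_, fun {γ δ} h => ?_, fun {γ δ ε} h h' => ?_⟩
    · rw [inv_mul_cancel]; exact Subgroup.one_mem _
    · have := (N.level n).inv_mem h
      rwa [mul_inv_rev, inv_inv] at this
    · have := (N.level n).mul_mem h h'
      rwa [mul_assoc, mul_inv_cancel_left] at this

/-- The truncated operad `PaB^{≤ 4} / ∼_N`. -/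
def quot (N : NFI) : TruncOp where
  Hom _ a b := Quotient (rel N a b)
  id a := Quotient.mk _ (PHom.id a)
  comp := Quotient.map₂ PHom.comp fun _ _ h _ _ h' => mul_rel h h'
  inv := Quotient.map PHom.inv fun γ δ (h : γ.1⁻¹ * δ.1 ∈ N.level _) => by
    have := (N.level_normal _).conj_mem _ ((N.level _).inv_mem h) γ.1
    change γ.1⁻¹⁻¹ * δ.1⁻¹ ∈ N.level _
    convert this using 1
    group
  act θ := Quotient.map (PHom.act θ) fun _ _ h => h
  ins {_ _ _ _ hnk _ _ _ _} i := Quotient.map₂ (fun γ δ => PHom.ins γ i δ)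
    fun _ _ h _ _ h' => insBraid_rel N hnk _ h h'

/-- The canonical projection `PaB^{≤ 4} → PaB^{≤ 4} / ∼_N`. -/
def proj (N : NFI) : PaB ⟶ quot N where
  map γ := Quotient.mk _ γ
  map_id _ := rfl
  map_comp _ _ := rfl
  map_inv _ := rfl
  map_act _ _ := rfl
  map_ins _ _ _ := rfl

/-- The canonical projection `PaB^{≤ 4} / ∼_K → PaB^{≤ 4} / ∼_N` for `K ≤ N`. -/
def projLE {K N : NFI} (h : K ≤ N) : quot K ⟶ quot N where
  map := Quotient.map _root_.id fun _ _ h' => level_mono h _ h'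
  map_id _ := rfl
  map_comp γ δ := by
    induction γ, δ using Quotient.inductionOn₂; rfl
  map_inv γ := by induction γ using Quotient.inductionOn; rfl
  map_act _ γ := by induction γ using Quotient.inductionOn; rfl
  map_ins _ γ δ := by induction γ, δ using Quotient.inductionOn₂; rfl

/-- The forgetful map from morphisms of `PaB(n) / ∼_N` to cosets of braids. A morphism of the quotient
is determined by its source, its target and this coset. -/
def ou (N : NFI) {n : ℕ} {hn : n ≤ 4} {a b : PObj n} :
    (quot N).Hom hn a b → Braid n ⧸ N.level n :=
  Quotient.map' (s₁ := rel N a b) (s₂ := QuotientGroup.leftRel (N.level n)) Subtype.val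
    fun _ _ h => QuotientGroup.leftRel_apply.mpr h

/-- The bracketing `((12)3)…` with `n + 1` leaves. -/
def leftTree : ℕ → FreeMagma Unit
  | 0 => .of ()
  | n + 1 => leftTree n * .of ()

theorem leftTree_length (n : ℕ) : (leftTree n).length = n + 1 := by
  induction n with
  | zero => rfl
  | succ n ih => simp [leftTree, ih]

/-- The object with the bracketing `((12)3)…` and labels given by `s`. -/
def leftObj (n : ℕ) (s : Equiv.Perm (Fin (n + 1))) : PObj (n + 1) :=
  ⟨leftTree n, leftTree_length n, s⟩

/-- The morphism of `PaB` with source `((12)3)…` given by the braid `g`. -/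
def mm {n : ℕ} (g : Braid (n + 1)) : PHom (leftObj n 1) (leftObj n (rho (n + 1) g)⁻¹) :=
  ⟨g, by simp [leftObj]⟩

/-- The object `1(23)`. -/
def rightObj : PObj 3 := ⟨.of () * (.of () * .of ()), rfl, 1⟩

/-- The associator `α : (12)3 → 1(23)`, given by the trivial braid. -/
def assoc : PHom (leftObj 2 1) rightObj := ⟨1, by simp [leftObj, rightObj]⟩

/-- The pure braid generator `x_{12} = σ_1 ^ 2`. -/
def x12 : Braid 3 := sg 3 0 ^ 2
/-- The pure braid generator `x_{23} = σ_2 ^ 2`. -/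
def x23 : Braid 3 := sg 3 1 ^ 2

/-- The free group on two generators, as the subgroup generated by `x_{12}` and `x_{23}`. -/
def F2 : Subgroup (Braid 3) := Subgroup.closure {x12, x23}

/-- The homomorphism from the braid group on `n + 1` strands to its quotient by `N_{PB_{n+1}}` which is
induced by `T`. -/
def onBraid {N : NFI} (T : PaB ⟶ quot N) {n : ℕ} (hn : n + 1 ≤ 4) (g : Braid (n + 1)) :
    Braid (n + 1) ⧸ N.level (n + 1) :=
  ou N (TruncOp.Mor.map T (hn := hn) (mm g))

/-- A GT-shadow with target `N` is a morphism of truncated operads from `PaB^{≤ 4}` to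
`PaB^{≤ 4} / ∼_N` that is onto. -/
structure IsShadow {N : NFI} (T : PaB ⟶ quot N) : Prop where
  onto {n : ℕ} (hn : n ≤ 4) (a b : PObj n) :
    Function.Surjective (TruncOp.Mor.map T : PaB.Hom hn a b → (quot N).Hom hn a b)

/-- Charming GT-shadows. Since the associator is given by the trivial braid, the coset `ou N (T α)` is
`f N_{PB_3}` when `T α = [α · m(f)]`; it has to be represented by an element of the commutator subgroup
of `F2`. Furthermore the homomorphism `F2 → F2 / (F2 ∩ N_{PB_3})` induced by `T` has to be onto. -/
structure IsCharming {N : NFI} (T : PaB ⟶ quot N) : Prop extends IsShadow T where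
  f_mem : ∃ f ∈ ⁅F2, F2⁆, ou N (TruncOp.Mor.map T (hn := by omega) assoc) = (f : Braid 3 ⧸ N.level 3)
  onto_F2 : ∀ g ∈ F2, ∃ h ∈ F2, onBraid T (n := 2) (by omega) h = (g : Braid 3 ⧸ N.level 3)

/-- A GT-shadow is settled if the kernel of the induced homomorphism on the braid group on four
strands is `N`. -/
def IsSettled {N : NFI} (T : PaB ⟶ quot N) : Prop :=
  ∀ g : Braid 4, onBraid T (n := 3) (by omega) g = (1 : Braid 4 ⧸ N.level 4) ↔ g ∈ N.toSubgroup

/-- Isolated elements: all charming GT-shadows with target `N` are settled. -/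
def NFI.IsIsolated (N : NFI) : Prop := ∀ T : PaB ⟶ quot N, IsCharming T → IsSettled T

/-- The poset of isolated elements. -/
abbrev IsolatedNFI : Type := {N : NFI // N.IsIsolated}

end GTShadow

open GTShadow

namespace GTShadow

/-! A settled shadow `T` has kernel `N` in arity 4. The subgroups `N.level 3` and `N.level 2` are
cut out by cofaces, and every coface is an operadic insertion involving an identity, so it commutes
with `T`. Hence `T` kills exactly the braids in `N.level n` in every arity (`IsSettled.detects`).
Being onto, `T` then descends to a bijection on morphisms of the quotient, that is, to an
automorphism (`IsSettled.exists_aut`). Uniqueness holds because `proj N` is epi.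

The group is realized as the automorphisms `S` for which `proj N ≫ S.hom` is charming. Closure under
products rests on the formulas for `T` on `x12` and `x23`: modulo `N.level 3`, a charming `T` maps
`F2` onto `F2`, hence its commutator subgroup onto itself (`IsCharming.map_commutator`), which
controls the associator of a composite (`IsCharming.comp`). Inverses come for free, since `Aut (quot
N)` is finite and an inverse is a power.

For `K ≤ N`, composing a charming shadow with `projLE` stays charming, so isolation of `N` turns the
result into an automorphism of `quot N`. It is the only one compatible with `projLE`, and this
uniqueness yields multiplicativity and functoriality. -/

/-! ### Braid cosets underlying the values of an operad morphism -/

theorem ou_mk (N : NFI) {n : ℕ} {hn : n ≤ 4} {a b : PObj n} (γ : PHom a b) :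
    ou N (hn := hn) (a := a) (b := b) (Quotient.mk (rel N a b) γ) = (γ.1 : Braid n ⧸ N.level n) :=
  rfl

theorem ou_injective (N : NFI) {n : ℕ} {hn : n ≤ 4} {a b : PObj n} :
    Function.Injective (ou N (hn := hn) (a := a) (b := b)) := by
  intro x y
  induction x using Quotient.inductionOn with | _ γ
  induction y using Quotient.inductionOn with | _ δ
  intro h
  exact Quotient.sound (QuotientGroup.eq.mp h)

theorem ou_comp (N : NFI) {n : ℕ} {hn : n ≤ 4} {a b c : PObj n} (x : (quot N).Hom hn b c)
    (y : (quot N).Hom hn a b) : ou N ((quot N).comp x y) = ou N x * ou N y := by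
  induction x using Quotient.inductionOn
  induction y using Quotient.inductionOn
  rfl

theorem ou_act (N : NFI) {n : ℕ} {hn : n ≤ 4} {a b : PObj n} (θ : Equiv.Perm (Fin n))
    (x : (quot N).Hom hn a b) : ou N ((quot N).act θ x) = ou N x := by
  induction x using Quotient.inductionOn
  rfl

theorem PHom.label_eq {n : ℕ} {a b : PObj n} (γ : PHom a b) :
    b.label = a.label * (rho n γ.1)⁻¹ := by
  rw [γ.2]; group

/-- The underlying coset of `T γ`, for a morphism `T` and a morphism `γ` of `PaB`. -/
abbrev coset {N : NFI} (T : PaB ⟶ quot N) {n : ℕ} (hn : n ≤ 4) {a b : PObj n} (γ : PHom a b) :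
    Braid n ⧸ N.level n :=
  ou N (TruncOp.Mor.map T (hn := hn) γ)

section
variable {N : NFI} (T : PaB ⟶ quot N) {n : ℕ} (hn : n ≤ 4)

theorem coset_comp {a b c : PObj n} (γ : PHom b c) (δ : PHom a b) :
    coset T hn (PHom.comp γ δ) = coset T hn γ * coset T hn δ := by
  refine Eq.trans ?_ (ou_comp N _ _)
  exact congrArg (ou N) (TruncOp.Mor.map_comp T γ δ)

/-- The two morphisms differ only by a relabelling: the braid determines the target labels from the
source labels, so the permutation relating the sources also relates the targets. `T` is equivariant,
and relabelling leaves cosets unchanged. -/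
theorem coset_congr {a b a' b' : PObj n} (γ : PHom a b) (γ' : PHom a' b') (ha : a.tree = a'.tree)
    (hb : b.tree = b'.tree) (h : γ.1 = γ'.1) : coset T hn γ = coset T hn γ' := by
  obtain ⟨t, ht, s⟩ := a
  obtain ⟨u, hu, r⟩ := b
  obtain ⟨t', ht', s'⟩ := a'
  obtain ⟨u', hu', r'⟩ := b'
  dsimp only at ha hb
  subst ha hb
  obtain ⟨θ, rfl⟩ : ∃ θ, s' = θ * s := ⟨s' * s⁻¹, by group⟩
  obtain rfl : r' = θ * r := by
    have h1 := γ.label_eq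
    have h2 := γ'.label_eq
    dsimp only at h1 h2
    rw [h1, h2, h, mul_assoc]
  obtain rfl : γ' = PHom.act θ γ := Subtype.ext h.symm
  refine (ou_act N θ (TruncOp.Mor.map T (hn := hn) γ)).symm.trans ?_
  exact congrArg (ou N) (TruncOp.Mor.map_act T θ γ).symm

theorem coset_id (a : PObj n) : coset T hn (PHom.id a) = 1 :=
  congrArg (ou N) (TruncOp.Mor.map_id T (hn := hn) a)

/-- Whether `T` kills a braid does not depend on the bracketing. -/
theorem coset_eq_one_iff {a b a' b' : PObj n} (γ : PHom a b) (γ' : PHom a' b')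
    (hab : a.tree = b.tree) (hab' : a'.tree = b'.tree) (h : γ.1 = γ'.1) :
    coset T hn γ = 1 ↔ coset T hn γ' = 1 := by
  -- Rebracketing by trivial braids conjugates one morphism into the other; `ψ` and `ψ'` have the
  -- same coset because source and target share their bracketing.
  let ψ : PHom a ⟨a'.tree, a'.length_tree, a.label⟩ := ⟨1, by simp⟩
  let ψ' : PHom b ⟨b'.tree, b'.length_tree, b.label⟩ := ⟨1, by simp⟩
  let δ : PHom (n := n) ⟨a'.tree, a'.length_tree, a.label⟩ ⟨b'.tree, b'.length_tree, b.label⟩ :=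
    ⟨γ.1, γ.2⟩
  have e : coset T hn ψ = coset T hn ψ' := coset_congr T hn _ _ hab hab' rfl
  have e1 : coset T hn γ' = coset T hn δ := coset_congr T hn _ _ rfl rfl h.symm
  have e2 : PHom.comp δ ψ = PHom.comp ψ' γ :=
    Subtype.ext ((mul_one _).trans (one_mul _).symm)
  have e3 := coset_comp T hn δ ψ
  rw [e2, coset_comp, e] at e3
  rw [e1, eq_mul_inv_of_mul_eq e3.symm, mul_inv_eq_one, mul_eq_left]

/-- A representative of the coset of `T γ` with the source and target of `γ`. -/
theorem exists_rep {a b : PObj n} (γ : PHom a b) :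
    ∃ δ : PHom a b, TruncOp.Mor.map T (hn := hn) γ = Quotient.mk (rel N a b) δ :=
  (Quotient.exists_rep _).imp fun _ => Eq.symm

end

/-- The homomorphism `T^{B_{n+1}}`. -/
def braidHom {N : NFI} (T : PaB ⟶ quot N) {n : ℕ} (hn : n + 1 ≤ 4) :
    Braid (n + 1) →* Braid (n + 1) ⧸ N.level (n + 1) :=
  MonoidHom.mk' (onBraid T hn) fun g h => by
    -- A relabelled copy of `mm g`, made composable with `mm h`.
    let γ : PHom (leftObj n (rho (n + 1) h)⁻¹) (leftObj n (rho (n + 1) (g * h))⁻¹) :=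
      ⟨g, by simp [leftObj]⟩
    have e : mm (g * h) = PHom.comp γ (mm h) := rfl
    have e' : onBraid T hn g = coset T hn γ := coset_congr T hn _ _ rfl rfl rfl
    rw [e']
    exact (congrArg (coset T hn) e).trans (coset_comp T hn _ _)

theorem coset_eq_braidHom {N : NFI} (T : PaB ⟶ quot N) {n : ℕ} (hn : n + 1 ≤ 4)
    {s r : Equiv.Perm (Fin (n + 1))} (γ : PHom (leftObj n s) (leftObj n r)) :
    coset T hn γ = braidHom T hn γ.1 :=
  coset_congr T hn _ _ rfl rfl rfl

/-! ### Kernels of settled shadows in lower arities -/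

/-- On morphisms between objects with the same bracketing, `T` kills exactly the braids in `N`. -/
def Detects {N : NFI} (T : PaB ⟶ quot N) {n : ℕ} (hn : n ≤ 4) : Prop :=
  ∀ (a b : PObj n) (γ : PHom a b), a.tree = b.tree → (coset T hn γ = 1 ↔ γ.1 ∈ N.level n)

theorem IsSettled.detects_four {N : NFI} {T : PaB ⟶ quot N} (h : IsSettled T) :
    Detects T (le_refl 4) := fun _ _ γ hab =>
  (coset_eq_one_iff T _ γ (mm (n := 3) γ.1) hab rfl rfl).trans (h γ.1)

theorem double_eq_insBraid {n : ℕ} (g : Braid n) (p : Fin n) :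
    insBraid g p (1 : Braid (1 + 1)) = double g p := by
  rw [insBraid, map_one, mul_one]; rfl

theorem cable_one {n : ℕ} (p : Fin n) (k : ℕ) : cable (1 : Braid n) p k = 1 := by
  induction k with
  | zero => rfl
  | succ k ih => rw [cable, ih, double_one]

theorem insBraid_one {n k : ℕ} (p : Fin n) (h : Braid (k + 1)) :
    insBraid 1 p h = shift (k + 1) (n + k) p (by omega) h := by
  rw [insBraid, cable_one, one_mul]

section
variable {N : NFI} {T : PaB ⟶ quot N}

/-- Doubling a strand is the insertion of an arity 2 identity, which `T` preserves. So the doubling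
of `δ` represents the image of the doubling of `γ`, and detection one arity higher compares them. -/
theorem Detects.double_mem_iff {n : ℕ} {hn : n ≤ 4} {hn' : n + 1 ≤ 4}
    (h : Detects T hn') {a b : PObj n} (hab : a.tree = b.tree) {γ δ : PHom a b}
    (e : TruncOp.Mor.map T (hn := hn) γ = Quotient.mk (rel N a b) δ)
    (hγ : rho n γ.1 = 1) (p : Fin n) :
    double γ.1 p ∈ N.level (n + 1) ↔ double δ.1 p ∈ N.level (n + 1) := by
  -- Purity makes the labels of `a` and `b` agree, so the insertion grafts at the same leaf on both
  -- sides and the bracketings stay equal.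
  have hl := γ.label_eq
  rw [hγ, inv_one, mul_one] at hl
  have e1 : TruncOp.Mor.map T (hn := hn') (PHom.ins γ (a.label p) (PHom.id (leftObj 1 1))) =
      Quotient.mk (rel N _ _) (PHom.ins δ (a.label p) (PHom.id (leftObj 1 1))) := by
    refine (TruncOp.Mor.map_ins T (hn := hn) (hk := by omega) (hnk := hn') (a.label p) γ
      (PHom.id (leftObj 1 1))).trans ?_
    have := TruncOp.Mor.map_id T (n := 2) (hn := by omega) (leftObj 1 1)
    rw [e]
    exact congrArg _ this
  have e2 := h _ _ (PHom.ins γ (a.label p) (PHom.id (leftObj 1 1))) (by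
    simp only [PObj.ins, hab, hl])
  rw [coset, e1, ou_mk, QuotientGroup.eq_one_iff] at e2
  have e3 : ∀ ε : PHom a b, (PHom.ins ε (a.label p) (PHom.id (leftObj 1 1))).1 = double ε.1 p := by
    intro ε
    refine (double_eq_insBraid _ _).trans ?_
    exact congrArg (double ε.1) (a.label.symm_apply_apply p)
  rw [e3, e3] at e2
  exact e2.symm

/-- Here the coface is the insertion of `γ` into the identity of arity 2: `q = 0` adds a trivial
strand on the right, `q = 1` on the left. -/
theorem Detects.shift_mem_iff {k : ℕ} {hn : k + 1 ≤ 4} {hn' : 2 + k ≤ 4}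
    (h : Detects T hn') {a b : PObj (k + 1)} (hab : a.tree = b.tree) {γ δ : PHom a b}
    (e : TruncOp.Mor.map T (hn := hn) γ = Quotient.mk (rel N a b) δ) (q : Fin 2) :
    shift (k + 1) (2 + k) q (by omega) γ.1 ∈ N.level (2 + k) ↔
      shift (k + 1) (2 + k) q (by omega) δ.1 ∈ N.level (2 + k) := by
  have e1 : TruncOp.Mor.map T (hn := hn') (PHom.ins (PHom.id (leftObj 1 1)) q γ) =
      Quotient.mk (rel N _ _) (PHom.ins (PHom.id (leftObj 1 1)) q δ) := by
    refine (TruncOp.Mor.map_ins T (hn := by omega) (hk := hn) (hnk := hn') q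
      (PHom.id (leftObj 1 1)) γ).trans ?_
    have := TruncOp.Mor.map_id T (n := 2) (hn := by omega) (leftObj 1 1)
    rw [e]
    exact congrArg (fun x => (quot N).ins q x _) this
  have e2 := h _ _ (PHom.ins (PHom.id (leftObj 1 1)) q γ) (by simp only [PObj.ins, hab])
  rw [coset, e1, ou_mk, QuotientGroup.eq_one_iff] at e2
  have e3 : ∀ ε : PHom a b, (PHom.ins (PHom.id (leftObj 1 1)) q ε).1 =
      shift (k + 1) (2 + k) q (by omega) ε.1 := fun ε => insBraid_one (n := 2) q ε.1
  rw [e3, e3] at e2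
  exact e2.symm

theorem Detects.pull {n : ℕ} (hn2 : 2 ≤ n) {hn : n ≤ 4} {hn' : n + 1 ≤ 4} (h : Detects T hn') :
    Detects T hn := by
  intro a b γ hab
  obtain ⟨δ, e⟩ := exists_rep T hn γ
  have hr : rho n δ.1 = rho n γ.1 := by rw [γ.2, δ.2]
  rw [coset, e, ou_mk, QuotientGroup.eq_one_iff]
  by_cases hγ : rho n γ.1 = 1
  · have hd := h.double_mem_iff hab e hγ
    -- For a concrete arity, `2 + k` and `k + 1 + 1` agree by computation, and `N.level n` unfolds
    -- to a `pull`.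
    obtain rfl | rfl : n = 2 ∨ n = 3 := by omega
    · have h0 := Detects.shift_mem_iff (k := 1) h hab e 0
      have h1 := Detects.shift_mem_iff (k := 1) h hab e 1
      exact ⟨fun ⟨_, p2, p3, p4⟩ => ⟨hγ, fun p => (hd p).mpr (p2 p), h0.mpr p3, h1.mpr p4⟩,
        fun ⟨_, p2, p3, p4⟩ => ⟨hr.trans hγ, fun p => (hd p).mp (p2 p), h0.mp p3, h1.mp p4⟩⟩
    · have h0 := Detects.shift_mem_iff (k := 2) h hab e 0
      have h1 := Detects.shift_mem_iff (k := 2) h hab e 1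
      exact ⟨fun ⟨_, p2, p3, p4⟩ => ⟨hγ, fun p => (hd p).mpr (p2 p), h0.mpr p3, h1.mpr p4⟩,
        fun ⟨_, p2, p3, p4⟩ => ⟨hr.trans hγ, fun p => (hd p).mp (p2 p), h0.mp p3, h1.mp p4⟩⟩
  -- If `γ` is not pure, neither is the parallel `δ`, and both memberships fail.
  · exact ⟨fun hm => absurd (hr.symm.trans (level_pure N hm)) hγ,
      fun hm => absurd (level_pure N hm) hγ⟩

theorem braid_eq_one {n : ℕ} (hn : n ≤ 1) (g : Braid n) : g = 1 := by
  induction g using braid_induction with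
  | one => rfl
  | gen j hj => omega
  | mul x y hx hy => rw [hx, hy, one_mul]
  | inv x hx => rw [hx, inv_one]

theorem IsSettled.detects (h : IsSettled T) {n : ℕ} (hn : n ≤ 4) : Detects T hn := by
  obtain hn1 | rfl | rfl | rfl : n ≤ 1 ∨ n = 2 ∨ n = 3 ∨ n = 4 := by omega
  · intro a b γ hab
    obtain ⟨δ, e⟩ := exists_rep T hn γ
    rw [coset, e, ou_mk, braid_eq_one hn1 γ.1, braid_eq_one hn1 δ.1]
    exact iff_of_true rfl (Subgroup.one_mem _)
  · exact (h.detects_four.pull (hn := by omega) (by omega)).pull le_rfl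
  · exact h.detects_four.pull (by omega)
  · exact h.detects_four

/-- Although `a` and `b` may be bracketed differently, `γ⁻¹ δ` is an endomorphism of `a`, to which
detection applies. -/
theorem Detects.map_eq_iff {n : ℕ} {hn : n ≤ 4} (h : Detects T hn) {a b : PObj n}
    (γ δ : PHom a b) : TruncOp.Mor.map T (hn := hn) γ = TruncOp.Mor.map T (hn := hn) δ ↔
      γ.1⁻¹ * δ.1 ∈ N.level n := by
  have e : coset T hn (PHom.inv γ) * coset T hn γ = 1 := by
    rw [← coset_comp, ← coset_id T hn a]
    exact congrArg (coset T hn) (Subtype.ext (inv_mul_cancel _))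
  have e' := h a a (PHom.comp (PHom.inv γ) δ) rfl
  rw [coset_comp, eq_inv_of_mul_eq_one_left e, inv_mul_eq_one] at e'
  exact (ou_injective N).eq_iff.symm.trans e'

end

/-! ### Factorization through the quotient operad -/

theorem TruncOp.hom_ext {P Q : TruncOp} {S T : P ⟶ Q}
    (h : ∀ (n : ℕ) (hn : n ≤ 4) (a b : PObj n) (γ : P.Hom hn a b),
      TruncOp.Mor.map S γ = TruncOp.Mor.map T γ) : S = T :=
  TruncOp.Mor.ext (by
    funext n hn a b γ
    exact h n hn a b γ)

instance proj_epi (N : NFI) : Epi (proj N) where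
  left_cancellation S T h := TruncOp.hom_ext fun n hn a b x => by
    induction x using Quotient.inductionOn with | _ γ
    exact congrArg (fun U : PaB ⟶ _ => TruncOp.Mor.map U (hn := hn) γ) h

/-- An operad morphism that is bijective on morphisms is an isomorphism. -/
noncomputable def isoOfBijective {P Q : TruncOp} (S : P ⟶ Q)
    (h : ∀ {n : ℕ} (hn : n ≤ 4) (a b : PObj n),
      Function.Bijective (TruncOp.Mor.map S : P.Hom hn a b → Q.Hom hn a b)) : P ≅ Q where
  hom := S
  inv :=
    { map := fun {_ hn a b} => (Equiv.ofBijective _ (h hn a b)).symm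
      map_id := fun a => (Equiv.symm_apply_eq _).mpr (TruncOp.Mor.map_id S a).symm
      map_comp := fun γ δ => (Equiv.symm_apply_eq _).mpr <| by
        refine Eq.trans ?_ (TruncOp.Mor.map_comp S _ _).symm
        exact congrArg₂ Q.comp (Equiv.ofBijective_apply_symm_apply _ (h _ _ _) _).symm
          (Equiv.ofBijective_apply_symm_apply _ (h _ _ _) _).symm
      map_inv := fun γ => (Equiv.symm_apply_eq _).mpr <| by
        refine Eq.trans ?_ (TruncOp.Mor.map_inv S _).symm
        exact congrArg Q.inv (Equiv.ofBijective_apply_symm_apply _ (h _ _ _) _).symm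
      map_act := fun θ γ => (Equiv.symm_apply_eq _).mpr <| by
        refine Eq.trans ?_ (TruncOp.Mor.map_act S θ _).symm
        exact congrArg (Q.act θ) (Equiv.ofBijective_apply_symm_apply _ (h _ _ _) _).symm
      map_ins := fun i γ δ => (Equiv.symm_apply_eq _).mpr <| by
        refine Eq.trans ?_ (TruncOp.Mor.map_ins S i _ _).symm
        exact congrArg₂ (Q.ins i) (Equiv.ofBijective_apply_symm_apply _ (h _ _ _) _).symm
          (Equiv.ofBijective_apply_symm_apply _ (h _ _ _) _).symm }
  hom_inv_id := TruncOp.hom_ext fun _ hn a b γ =>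
    Equiv.ofBijective_symm_apply_apply _ (h hn a b) γ
  inv_hom_id := TruncOp.hom_ext fun _ hn a b γ =>
    Equiv.ofBijective_apply_symm_apply _ (h hn a b) γ

/-- A morphism that identifies equivalent morphisms of `PaB` factors through the quotient. -/
def desc {N : NFI} {Q : TruncOp} (T : PaB ⟶ Q)
    (h : ∀ {n : ℕ} (hn : n ≤ 4) (a b : PObj n) (γ δ : PHom a b), γ.1⁻¹ * δ.1 ∈ N.level n →
      TruncOp.Mor.map T (hn := hn) γ = TruncOp.Mor.map T (hn := hn) δ) : quot N ⟶ Q where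
  map {_ hn a b} := Quotient.lift (fun γ : PHom a b => TruncOp.Mor.map T (hn := hn) γ) (h hn a b)
  map_id a := TruncOp.Mor.map_id T a
  map_comp x y := by
    induction x using Quotient.inductionOn with | _ γ
    induction y using Quotient.inductionOn with | _ δ
    exact TruncOp.Mor.map_comp T γ δ
  map_inv x := by
    induction x using Quotient.inductionOn with | _ γ
    exact TruncOp.Mor.map_inv T γ
  map_act θ x := by
    induction x using Quotient.inductionOn with | _ γ
    exact TruncOp.Mor.map_act T θ γ
  map_ins i x y := by
    induction x using Quotient.inductionOn with | _ γ
    induction y using Quotient.inductionOn with | _ δ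
    exact TruncOp.Mor.map_ins T i γ δ

/-- Detection makes `T` descend and makes the descended map injective; ontoness of `T` makes it
surjective. -/
theorem IsSettled.exists_aut {N : NFI} {T : PaB ⟶ quot N} (hT : IsSettled T) (h : IsShadow T) :
    ∃ S : Aut (quot N), proj N ≫ S.hom = T := by
  refine ⟨isoOfBijective (desc T fun hn a b γ δ => ((hT.detects hn).map_eq_iff γ δ).mpr)
    fun hn a b => ⟨?_, ?_⟩, rfl⟩
  · intro x y
    induction x using Quotient.inductionOn with | _ γ
    induction y using Quotient.inductionOn with | _ δ
    exact fun e => Quotient.sound (((hT.detects hn).map_eq_iff γ δ).mp e)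
  · intro y
    obtain ⟨γ, e⟩ := h.onto hn a b y
    exact ⟨Quotient.mk (rel N a b) γ, e⟩

/-! ### Finiteness of the automorphism group -/

/-- The permutation of a braid and the cosets of its cofaces take finitely many values and determine
its coset. Doubling is only a crossed homomorphism, so chosen coset representatives are compared
instead of forming a kernel. -/
theorem pull_finiteIndex {n : ℕ} (N : Subgroup (Braid (n + 1))) [hN : N.FiniteIndex] :
    (pull N).FiniteIndex := by
  let f : Braid n → Equiv.Perm (Fin n) × (Fin n → Braid (n + 1) ⧸ N) ×
      (Braid (n + 1) ⧸ N) × (Braid (n + 1) ⧸ N) := fun g =>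
    (rho n g, fun p => double g p, shift n (n + 1) 0 (by omega) g,
      shift n (n + 1) 1 (by omega) g)
  have hf : ∀ g h, f g = f h → g⁻¹ * h ∈ pull N := by
    intro g h e
    simp only [f, Prod.mk.injEq, funext_iff, QuotientGroup.eq] at e
    obtain ⟨e1, e2, e3, e4⟩ := e
    refine ⟨by rw [map_mul, map_inv, e1, inv_mul_cancel], fun p => ?_, ?_, ?_⟩
    · rw [double_mul, double_inv, ← e1]
      simpa using e2 p
    · rwa [map_mul, map_inv]
    · rwa [map_mul, map_inv]
  have : Finite (Braid n ⧸ pull N) := by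
    refine Finite.of_injective (fun x => f x.out) fun x y e => ?_
    rw [← QuotientGroup.out_eq' x, ← QuotientGroup.out_eq' y]
    exact QuotientGroup.eq.mpr (hf _ _ e)
  exact Subgroup.finiteIndex_of_finite_quotient

theorem level_finiteIndex (N : NFI) {n : ℕ} (hn : n ≤ 4) : (N.level n).FiniteIndex := by
  have h4 : N.toSubgroup.FiniteIndex := N.finiteIndex
  have h3 : (pull N.toSubgroup).FiniteIndex := pull_finiteIndex _
  have h2 : (pull (pull N.toSubgroup)).FiniteIndex := pull_finiteIndex _
  obtain hn1 | rfl | rfl | rfl : n ≤ 1 ∨ n = 2 ∨ n = 3 ∨ n = 4 := by omega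
  · have : Subsingleton (Braid n) := ⟨fun g h => by rw [braid_eq_one hn1 g, braid_eq_one hn1 h]⟩
    infer_instance
  · exact h2
  · exact h3
  · exact h4

theorem finite_hom (N : NFI) {n : ℕ} (hn : n ≤ 4) (a b : PObj n) :
    Finite ((quot N).Hom hn a b) := by
  have := level_finiteIndex N hn
  exact Finite.of_injective _ (ou_injective N)

theorem finite_length_le (n : ℕ) : {t : FreeMagma Unit | t.length ≤ n}.Finite := by
  induction n with
  | zero =>
    refine Set.Finite.subset Set.finite_empty fun t ht => ?_
    exact absurd (FreeMagma.length_pos t) (by simpa using ht)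
  | succ n ih =>
    refine ((Set.finite_singleton (FreeMagma.of ())).union (ih.image2 FreeMagma.mul ih)).subset ?_
    intro t ht
    cases t with
    | of x => exact Or.inl rfl
    | mul t u =>
      have h1 := FreeMagma.length_pos t
      have h2 := FreeMagma.length_pos u
      have h : t.length + u.length ≤ n + 1 := ht
      exact Or.inr ⟨t, by simp only [Set.mem_ofPred_eq]; omega, u,
        by simp only [Set.mem_ofPred_eq]; omega, rfl⟩

instance finite_PObj (n : ℕ) : Finite (PObj n) := by
  have := (finite_length_le n).to_subtype
  refine Finite.of_injective (fun a : PObj n =>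
    ((⟨a.tree, a.length_tree.le⟩, a.label) :
      {t : FreeMagma Unit | t.length ≤ n} × Equiv.Perm (Fin n))) ?_
  rintro ⟨t, h, s⟩ ⟨t', h', s'⟩ e
  simp only [Prod.mk.injEq, Subtype.mk.injEq] at e
  obtain ⟨rfl, rfl⟩ := e
  rfl

instance finite_aut (N : NFI) : Finite (Aut (quot N)) := by
  have := @finite_hom N
  -- `Fin 5` runs over the arities `0, …, 4`; each has finitely many objects and finite hom sets.
  refine Finite.of_injective (fun (S : Aut (quot N)) (n : Fin 5) (a b : PObj n) =>
    (TruncOp.Mor.map S.hom : (quot N).Hom (by omega) a b → (quot N).Hom (by omega) a b)) ?_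
  intro S S' e
  refine Iso.ext (TruncOp.hom_ext fun n hn a b γ => ?_)
  exact congrFun (congrFun (congrFun (congrFun e ⟨n, by omega⟩) a) b) γ

/-! ### The action of a shadow on `F2` -/

theorem adj_mul_self (n j : ℕ) : adj n j * adj n j = 1 := by
  nth_rw 1 [← adj_inv]
  exact inv_mul_cancel _

section
variable {N : NFI} (T : PaB ⟶ quot N)

/-- `Braid 2` is cyclic, so the image of the square of its generator is represented by a pure braid,
hence by an even power of the generator; insertion into an identity carries this to arity 3. -/
theorem coset_shift_sq (q : Fin 2) :
    ∃ k : ℤ, coset T (n := 3) (by omega) (PHom.ins (PHom.id (leftObj 1 1)) q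
      (mm (n := 1) (sg 2 0 ^ 2))) = (((sg 3 q) ^ 2) ^ k : Braid 3) := by
  obtain ⟨δ, e⟩ := exists_rep T (n := 2) (by omega) (mm (n := 1) (sg 2 0 ^ 2))
  have hr : rho 2 δ.1 = 1 := by
    have h1 : rho 2 (sg 2 0 ^ 2) = 1 := by
      rw [map_pow, rho_sg (by omega), sq, adj_mul_self]
    rw [δ.2, ← (mm (n := 1) (sg 2 0 ^ 2)).2]
    exact h1
  obtain ⟨k, hk⟩ : ∃ k : ℤ, δ.1 = (sg 2 0 ^ 2) ^ k := by
    obtain ⟨m, hm⟩ : ∃ m : ℤ, (δ.1 : Braid 2) = sg 2 0 ^ m := by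
      induction δ.1 using braid_induction with
      | one => exact ⟨0, by simp⟩
      | gen j hj => exact ⟨1, by rw [zpow_one, show j = 0 by omega]⟩
      | mul x y hx hy =>
        obtain ⟨m, rfl⟩ := hx
        obtain ⟨l, rfl⟩ := hy
        exact ⟨m + l, (zpow_add _ _ _).symm⟩
      | inv x hx =>
        obtain ⟨m, rfl⟩ := hx
        exact ⟨-m, (zpow_neg _ _).symm⟩
    rw [hm, map_zpow, rho_sg (by omega)] at hr
    rcases Int.even_or_odd' m with ⟨l, rfl | rfl⟩
    · exact ⟨l, by rw [hm, zpow_mul]; rfl⟩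
    · rw [zpow_add, zpow_mul, zpow_ofNat, sq, adj_mul_self, one_zpow, one_mul, zpow_one] at hr
      exact absurd (congrArg (fun s => ((s 0 : Fin 2) : ℕ)) hr) (by
        simp only [adj_val (show 0 + 1 < 2 by omega)]; simp)
  refine ⟨k, ?_⟩
  have e1 : TruncOp.Mor.map T (hn := show 3 ≤ 4 by omega)
      (PHom.ins (n := 2) (k := 1) (PHom.id (leftObj 1 1)) q (mm (n := 1) (sg 2 0 ^ 2))) =
        Quotient.mk (rel N _ _) (PHom.ins (n := 2) (k := 1) (PHom.id (leftObj 1 1)) q δ) := by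
    refine (TruncOp.Mor.map_ins T (n := 2) (k := 1) (hn := by omega) (hk := by omega)
      (hnk := by omega) q (PHom.id (leftObj 1 1)) (mm (n := 1) (sg 2 0 ^ 2))).trans ?_
    have := TruncOp.Mor.map_id T (n := 2) (hn := by omega) (leftObj 1 1)
    rw [e]
    exact congrArg (fun x => (quot N).ins q x _) this
  refine (congrArg (ou N) e1).trans ?_
  refine congrArg _ ((insBraid_one (n := 2) (k := 1) q δ.1).trans ?_)
  rw [hk, map_zpow, map_pow, shift_sg _ (by omega)]
  rfl

theorem braidHom_x12 : ∃ k : ℤ, braidHom T (n := 2) (by omega) x12 = (x12 ^ k : Braid 3) := by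
  obtain ⟨k, hk⟩ := coset_shift_sq T 0
  refine ⟨k, Eq.trans ?_ hk⟩
  refine coset_congr T (n := 3) _ _ _ rfl ?_ ?_
  · rfl
  · exact ((insBraid_one (n := 2) (k := 1) 0 (sg 2 0 ^ 2)).trans (by
      rw [map_pow, shift_sg _ (by omega)]; rfl)).symm

/-- The insertion producing `x23` lives on `1(23)`, whereas `braidHom` uses `(12)3`. Conjugating by
the associator moves it there. -/
theorem braidHom_x23 : ∃ k : ℤ, braidHom T (n := 2) (by omega) x23 =
    (coset T (by omega) assoc)⁻¹ * (x23 ^ k : Braid 3) * coset T (by omega) assoc := by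
  obtain ⟨k, hk⟩ := coset_shift_sq T 1
  refine ⟨k, ?_⟩
  have hx : rho 3 x23 = 1 := by
    rw [x23, map_pow, rho_sg (by omega), sq, adj_mul_self]
  let γ : PHom (leftObj 2 1) (leftObj 2 1) := ⟨x23, by rw [hx]; simp⟩
  let δ : PHom rightObj rightObj := ⟨x23, by rw [hx]; simp⟩
  have e : PHom.comp assoc γ = PHom.comp δ assoc :=
    Subtype.ext ((one_mul _).trans (mul_one _).symm)
  have e1 := coset_comp T (n := 3) (by omega) assoc γ
  rw [e, coset_comp, coset_eq_braidHom] at e1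
  rw [mul_assoc, eq_inv_mul_iff_mul_eq]
  refine e1.symm.trans (congrArg (· * _) (Eq.trans ?_ hk))
  refine coset_congr T (n := 3) _ _ _ rfl rfl ?_
  exact ((insBraid_one (n := 2) (k := 1) 1 (sg 2 0 ^ 2)).trans (by
      rw [map_pow, shift_sg _ (by omega)]; rfl)).symm

end

/-- One inclusion comes from the images of the two generators, the associator coset being
represented in `F2`; the other is the ontoness required of charming shadows. -/
theorem IsCharming.map_F2 {N : NFI} {T : PaB ⟶ quot N} (h : IsCharming T) :
    F2.map (braidHom T (n := 2) (by omega)) = F2.map (QuotientGroup.mk' (N.level 3)) := by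
  apply le_antisymm
  · obtain ⟨f, hf, e⟩ := h.f_mem
    have hf' : f ∈ F2 := Subgroup.commutator_le_self _ hf
    have h12 : x12 ∈ F2 := Subgroup.subset_closure (by simp)
    have h23 : x23 ∈ F2 := Subgroup.subset_closure (by simp)
    rw [Subgroup.map_le_iff_le_comap, F2, Subgroup.closure_le, Set.insert_subset_iff,
      Set.singleton_subset_iff]
    constructor
    · obtain ⟨k, hk⟩ := braidHom_x12 T
      exact ⟨_, F2.zpow_mem h12 k, hk.symm⟩
    · obtain ⟨k, hk⟩ := braidHom_x23 T
      refine ⟨f⁻¹ * x23 ^ k * f, F2.mul_mem (F2.mul_mem (F2.inv_mem hf') (F2.zpow_mem h23 k)) hf',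
        Eq.trans ?_ hk.symm⟩
      rw [coset, e]
      rfl
  · rintro _ ⟨g, hg, rfl⟩
    obtain ⟨k, hk, e⟩ := h.onto_F2 g hg
    exact ⟨k, hk, e⟩

/-- `T^{B_3}` preserves the commutator subgroup of `F2` modulo `N`. -/
theorem IsCharming.map_commutator {N : NFI} {T : PaB ⟶ quot N} (h : IsCharming T) :
    ⁅F2, F2⁆.map (braidHom T (n := 2) (by omega)) =
      ⁅F2, F2⁆.map (QuotientGroup.mk' (N.level 3)) := by
  rw [Subgroup.map_commutator, Subgroup.map_commutator, h.map_F2]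

/-! ### Composition and reduction of charming shadows -/

section
variable {N : NFI} (S : quot N ⟶ quot N)

/-- A morphism of the form `proj N ≫ S` factors through the quotient, so it kills the pure braid
`g⁻¹ * h`. -/
theorem braidHom_eq_of_rel {n : ℕ} (hn : n + 1 ≤ 4) {g h : Braid (n + 1)}
    (e : (g : Braid (n + 1) ⧸ N.level (n + 1)) = h) :
    braidHom (proj N ≫ S) hn g = braidHom (proj N ≫ S) hn h := by
  have hm := QuotientGroup.eq.mp e
  have hr := level_pure N hm
  rw [← inv_mul_eq_one, ← map_inv, ← map_mul]
  let γ : PHom (leftObj n 1) (leftObj n 1) := ⟨g⁻¹ * h, by rw [hr]; simp⟩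
  refine (coset_eq_braidHom _ hn γ).symm.trans ?_
  rw [← coset_id (proj N ≫ S) hn (leftObj n 1)]
  have e1 : TruncOp.Mor.map (proj N) (hn := hn) γ =
      TruncOp.Mor.map (proj N) (hn := hn) (PHom.id (leftObj n 1)) :=
    Quotient.sound (Setoid.symm' _ (by
      change (1 : Braid (n + 1))⁻¹ * (g⁻¹ * h) ∈ _
      rwa [inv_one, one_mul]))
  exact congrArg (fun x => ou N (TruncOp.Mor.map S x)) e1

theorem coset_comp_end {n : ℕ} (hn : n ≤ 4) (T : PaB ⟶ quot N) {a b : PObj n} {γ δ : PHom a b}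
    (e : TruncOp.Mor.map T (hn := hn) γ = Quotient.mk (rel N a b) δ) :
    coset (T ≫ S) hn γ = coset (proj N ≫ S) hn δ :=
  congrArg (fun x => ou N (TruncOp.Mor.map S x)) e

theorem onBraid_comp_end {n : ℕ} (hn : n + 1 ≤ 4) (T : PaB ⟶ quot N) {g h : Braid (n + 1)}
    (e : onBraid T hn g = (h : Braid (n + 1) ⧸ N.level (n + 1))) :
    onBraid (T ≫ S) hn g = onBraid (proj N ≫ S) hn h := by
  obtain ⟨δ, e1⟩ := exists_rep T hn (mm g)
  rw [onBraid, e1] at e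
  exact ((coset_comp_end S hn T e1).trans (coset_eq_braidHom _ hn δ)).trans
    (braidHom_eq_of_rel S hn e)

theorem IsCharming.comp {T : PaB ⟶ quot N} (hT : IsCharming T) {S : quot N ⟶ quot N}
    (hS : IsCharming (proj N ≫ S)) : IsCharming (T ≫ S) where
  onto hn a b y := by
    obtain ⟨γ, e⟩ := hS.onto hn a b y
    obtain ⟨δ, e'⟩ := hT.onto hn a b (Quotient.mk (rel N a b) γ)
    exact ⟨δ, (congrArg (TruncOp.Mor.map S) e').trans e⟩
  f_mem := by
    obtain ⟨f, hf, ef⟩ := hS.f_mem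
    obtain ⟨g, hg, eg⟩ := hT.f_mem
    obtain ⟨δ, e⟩ := exists_rep T (n := 3) (by omega) assoc
    rw [e, ou_mk] at eg
    obtain ⟨g', hg', eg'⟩ : braidHom (proj N ≫ S) (n := 2) (by omega) g ∈
        ⁅F2, F2⁆.map (QuotientGroup.mk' (N.level 3)) := by
      rw [← hS.map_commutator]
      exact Subgroup.mem_map_of_mem _ hg
    -- `T` sends the associator to the class of the associator composed with a braid congruent to
    -- `g`. Applying `S` gives `f` from the associator and `g'` from that braid.
    refine ⟨f * g', Subgroup.mul_mem _ hf hg', (coset_comp_end S _ T e).trans ?_⟩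
    -- The braid of `δ` with its target rebracketed to the left.
    let γ : PHom (leftObj 2 1) (leftObj 2 1) := ⟨δ.1, δ.2⟩
    have e1 : δ = PHom.comp assoc γ := Subtype.ext (one_mul _).symm
    rw [e1, coset_comp, coset_eq_braidHom]
    have e2 : braidHom (proj N ≫ S) (n := 2) (by omega) γ.1 = (g' : Braid 3 ⧸ N.level 3) :=
      (braidHom_eq_of_rel S (n := 2) _ eg).trans eg'.symm
    rw [e2]
    exact congrArg (· * (g' : Braid 3 ⧸ N.level 3)) ef
  onto_F2 g hg := by
    obtain ⟨h, hh, e⟩ := hS.onto_F2 g hg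
    obtain ⟨k, hk, e'⟩ := hT.onto_F2 h hh
    exact ⟨k, hk, (onBraid_comp_end S _ T e').trans e⟩

end

theorem isCharming_proj (N : NFI) : IsCharming (proj N) where
  onto _ _ _ y := Quotient.exists_rep y
  f_mem := ⟨1, Subgroup.one_mem _, rfl⟩
  onto_F2 g hg := ⟨g, hg, rfl⟩

theorem ou_projLE {K N : NFI} (h : K ≤ N) {n : ℕ} {hn : n ≤ 4} {a b : PObj n}
    {x : (quot K).Hom hn a b} {g : Braid n} (e : ou K x = g) :
    ou N (TruncOp.Mor.map (projLE h) x) = g := by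
  induction x using Quotient.inductionOn with | _ γ
  exact QuotientGroup.eq.mpr (level_mono h n (QuotientGroup.eq.mp e))

theorem IsCharming.comp_projLE {K N : NFI} (h : K ≤ N) {T : PaB ⟶ quot K} (hT : IsCharming T) :
    IsCharming (T ≫ projLE h) where
  onto hn a b y := by
    induction y using Quotient.inductionOn with | _ γ
    obtain ⟨δ, e⟩ := hT.onto hn a b (Quotient.mk (rel K a b) γ)
    exact ⟨δ, congrArg (TruncOp.Mor.map (projLE h)) e⟩
  f_mem := by
    obtain ⟨f, hf, e⟩ := hT.f_mem
    exact ⟨f, hf, ou_projLE h e⟩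
  onto_F2 g hg := by
    obtain ⟨k, hk, e⟩ := hT.onto_F2 g hg
    exact ⟨k, hk, ou_projLE h e⟩

/-! ### The groups `ML(N)` and their transition maps -/

/-- The group `ML(N)`: the automorphisms of the quotient operad that come from charming
GT-shadows, namely the `T^{isom}`. -/
def charmingAut (N : NFI) : Subgroup (Aut (quot N)) :=
  let M : Submonoid (Aut (quot N)) :=
    { carrier := {S | IsCharming (proj N ≫ S.hom)}
      one_mem' := isCharming_proj N
      -- In `Aut`, the product `S * S'` applies `S'` before `S`, which matches the multiplication
      -- `T₁^isom ∘ T₂`.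
      mul_mem' := fun hS hS' => hS'.comp hS }
  { M with
    -- `S` has finite order, so its inverse is among its nonnegative powers, which lie in `M`.
    inv_mem' := fun {S} hS =>
      (Submonoid.powers_le.mpr hS : Submonoid.powers S ≤ M)
        ((isOfFinOrder_of_finite S).mem_powers_iff_mem_zpowers.mpr
          (inv_mem (Subgroup.mem_zpowers S))) }

theorem bijOn_charmingAut {N : NFI} (hN : N.IsIsolated) :
    Set.BijOn (fun S : charmingAut N => proj N ≫ S.1.hom) Set.univ {T | IsCharming T} := by
  refine ⟨fun S _ => S.2, fun S _ S' _ e => ?_, fun T hT => ?_⟩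
  · exact Subtype.ext (Iso.ext ((cancel_epi (proj N)).mp e))
  · obtain ⟨S, rfl⟩ := (hN T hT).exists_aut hT.toIsShadow
    exact ⟨⟨S, hT⟩, trivial, rfl⟩

theorem proj_comp_projLE {K N : NFI} (h : K ≤ N) : proj K ≫ projLE h = proj N := rfl

/-- The shadow of `S` pushed to `quot N` is charming, hence comes from some `S'` as `N` is isolated;
cancelling the epimorphism `proj K` gives the square. -/
theorem exists_transition {K N : NFI} (hN : N.IsIsolated) (h : K ≤ N) (S : charmingAut K) :
    ∃ S' : charmingAut N, projLE h ≫ S'.1.hom = S.1.hom ≫ projLE h := by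
  obtain ⟨S', -, e⟩ := (bijOn_charmingAut hN).surjOn (S.2.comp_projLE h)
  refine ⟨S', (cancel_epi (proj K)).mp ?_⟩
  rw [← Category.assoc, proj_comp_projLE, ← Category.assoc]
  exact e

theorem transition_unique {K N : NFI} (h : K ≤ N) {S S' : charmingAut N}
    (e : projLE h ≫ S.1.hom = projLE h ≫ S'.1.hom) : S = S' := by
  refine Subtype.ext (Iso.ext ((cancel_epi (proj N)).mp ?_))
  rw [← proj_comp_projLE h, Category.assoc, Category.assoc, e]

/-- The homomorphism `ML_{K,N}`. -/
noncomputable def transition {K N : NFI} (hN : N.IsIsolated) (h : K ≤ N) :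
    charmingAut K →* charmingAut N :=
  MonoidHom.mk' (fun S => (exists_transition hN h S).choose) fun S S' => by
    apply transition_unique h
    have e := (exists_transition hN h S).choose_spec
    have e' := (exists_transition hN h S').choose_spec
    rw [(exists_transition hN h (S * S')).choose_spec]
    change (S'.1.hom ≫ S.1.hom) ≫ projLE h = projLE h ≫ Iso.hom _ ≫ Iso.hom _
    rw [← Category.assoc (projLE h), e', Category.assoc, Category.assoc, e]

theorem projLE_comp_transition {K N : NFI} (hN : N.IsIsolated) (h : K ≤ N) (S : charmingAut K) :
    projLE h ≫ (transition hN h S).1.hom = S.1.hom ≫ projLE h :=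
  (exists_transition hN h S).choose_spec

theorem projLE_refl (N : NFI) (h : N ≤ N) : projLE h = 𝟙 (quot N) :=
  (cancel_epi (proj N)).mp rfl

/-- The functor `ML`. -/
noncomputable def ML : IsolatedNFI ⥤ FiniteGrp.{0} where
  obj N := FiniteGrp.of (charmingAut N.1)
  map {_ N} f := FiniteGrp.ofHom (transition N.2 (leOfHom f))
  map_id N := by
    ext S
    refine transition_unique (le_refl N.1) ((projLE_comp_transition N.2 _ S).trans ?_)
    rw [projLE_refl, Category.comp_id, Category.id_comp]
    rfl
  map_comp {K N P} f g := by
    ext S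
    have hKP : K.1 ≤ P.1 := leOfHom (f ≫ g)
    refine transition_unique hKP ((projLE_comp_transition P.2 hKP S).trans ?_)
    have e1 := projLE_comp_transition N.2 (leOfHom f) S
    have e2 := projLE_comp_transition P.2 (leOfHom g) (transition N.2 (leOfHom f) S)
    -- Pasting the two transition squares along this factorization gives the square that
    -- characterizes the composite.
    have e : projLE hKP = projLE (K := K.1) (N := N.1) (leOfHom f) ≫ projLE (leOfHom g) :=
      (cancel_epi (proj K.1)).mp rfl
    rw [e, ← Category.assoc, ← e1, Category.assoc, ← e2, Category.assoc]
    rfl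

end GTShadow

open GTShadow
-- As `Φ N` is a homomorphism, the bijection with charming shadows transports the group law of `Aut
-- (quot N)`, which is why the multiplication is not spelled out separately.
theorem proposition3p6 :
    ∃ (ML : IsolatedNFI ⥤ FiniteGrp.{0}) (Φ : ∀ N : IsolatedNFI, ML.obj N →* Aut (quot N.1)),
      (∀ N : IsolatedNFI,
        Set.BijOn (fun a : ML.obj N => proj N.1 ≫ (Φ N a).hom) Set.univ {T | IsCharming T}) ∧
      ∀ (K N : IsolatedNFI) (h : K ≤ N) (a : ML.obj K),
        proj N.1 ≫ (Φ N (ML.map (homOfLE h) a)).hom = (proj K.1 ≫ (Φ K a).hom) ≫ projLE h := by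
  refine ⟨ML, fun N => (charmingAut N.1).subtype, fun N => bijOn_charmingAut N.2,
    fun K N h S => ?_⟩
  rw [Category.assoc]
  exact congrArg (proj K.1 ≫ ·) (projLE_comp_transition N.2 h S)
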